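/- **Setting.** An HRLQ instance $G$ consists of finite sets $\mathcal R$ (residents) and $\mathcal H$ (hospitals), a set $E\subseteq\mathcal R\times\mathcal H$ of acceptable pairs, for each vertex a strict preference list over its neighbours, and for each hospital $h$ an upper quota $q^+(h)\ge 1$ and a lower quota $q^-(h)\ge 0$. A *matching* $M\subseteq E$ assigns each resident $r$ to at most one hospital $M(r)$ (write $M(r)=\bot$ if there is none) and each hospital $h$ to a set $M(h)$ of at most $q^+(h)$ residents; it is *feasible* if $|M(h)|\ge q^-(h)$ for all $h$. A pair $(r,h)\in E\setminus M$ *blocks* $M$ if $r$ is unmatched or prefers $h$ to $M(r)$, and $|M(h)|<q^+(h)$ or $h$ prefers $r$ to some $r'\in M(h)$; $M$ is *stable* if no pair blocks it. **Popularity.** Every vertex prefers each of its neighbours to $\bot$. For a vertex $u$, $vote_u(x,y)$ is $1$, $-1$ or $0$ according as $u$ prefers $x$ to $y$, prefers $y$ to $x$, or $x=y$. For a resident, $vote_r(M,M')=vote_r(M(r),M'(r))$. For a hospital $h$, fill up $M(h)$ and $M'(h)$ with copies of $\bot$ to multisets of size $q^+(h)$. A function $\mathbf{corr}_h$ chooses,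 for all matchings $M,M'$, a one-to-one pairing of the multiset difference $M(h)\setminus M'(h)$ with $M'(h)\setminus M(h)$, and $vote_h(M,M')=\sum_{(x,y)}vote_h(x,y)$ over its pairs $(x,y)$. $M$ is *more popular* than $M'$ if $\sum_{u\in\mathcal R\cup\mathcal H}vote_u(M,M')>\sum_{u\in\mathcal R\cup\mathcal H}vote_u(M',M)$. A feasible matching is *popular amongst the feasible matchings* if no feasible matching is more popular than it. **Algorithm.** Start with $M=\emptyset$, all hospitals at level $0$ and in a first-in-first-out queue $Q$ (in any order), all residents at level $-1$. $Q$ holds each hospital at most once: adding a hospital already in $Q$ has no effect. While $Q\neq\emptyset$, remove the first hospital $h$ of $Q$. 1. If there is a resident on the list of $h$ to whom $h$ has not yet proposed with its current level, then $h$ proposes to the one, $r$, that it most prefers. - If $r$ is matched, say to $h'$ (possibly $h'=h$), then $r$ accepts if and only if $level(r)<level(h)$, or $level(r)=level(h)$ and $r$ prefers $h$ to $h'$. If $r$ does not accept, $h$ is added to $Q$ and the round ends. If $r$ accepts, $(r,h')$ is removed from $M$ and $h'$ is added to $Q$. An unmatched $r$ always accepts. - On acceptance, $(r,h)$ is added to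 $M$ and $level(r)$ is set to $level(h)$; then $h$ is added to $Q$ if $level(h)=0$ and $|M(h)|<q^+(h)$, or if $|M(h)|<q^-(h)$. 2. Otherwise, if $|M(h)|<q^-(h)$ and $level(h)<|\mathcal R|$, then $level(h)$ is increased by $1$ and $h$ is added to $Q$. When $Q$ is empty, output $M$. **Theorem.** Let $G$ be an HRLQ instance that admits a feasible matching. Then the algorithm terminates, for every initial order of the hospitals in $Q$, and its output $M$ is a feasible matching. For every choice of the functions $\mathbf{corr}_h$, $M$ is popular amongst the feasible matchings. If $G$ admits a matching that is both feasible and stable, then $M$ is stable. -/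

import Mathlib

/-- An instance of the hospital residents problem with lower quotas, on a set `R` of residents and
a set `H` of hospitals. Every vertex has a strictly ordered preference list (most preferred first)
of its neighbours; `r` and `h` are joined by an edge when they are on each other's lists. -/
structure HRLQ (R H : Type*) where
  resList : R → List H
  hosList : H → List R
  resList_nodup : ∀ r, (resList r).Nodup
  hosList_nodup : ∀ h, (hosList h).Nodup
  mutual_acceptable : ∀ r h, h ∈ resList r ↔ r ∈ hosList h
  /-- the upper quota of a hospital -/
  upper : H → ℕ
  /-- the lower quota of a hospital -/
  lower : H → ℕ
  upper_pos : ∀ h, 0 < upper h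

namespace HRLQ

variable {R H : Type*} [Fintype R] [Fintype H] [DecidableEq R] [DecidableEq H]

/-- `(r, h)` is an edge of the acceptability graph. -/
def Edge (G : HRLQ R H) (r : R) (h : H) : Prop := h ∈ G.resList r

/-- Position of an entry on a preference list; `none` (being unmatched, an empty place)
comes after all the entries of the list. -/
def rank {α : Type*} [DecidableEq α] (l : List α) : Option α → ℕ
  | some a => l.idxOf a
  | none => l.length

/-- The vertex with preference list `l` prefers `x` to `y`. -/
def Prefers {α : Type*} [DecidableEq α] (l : List α) (x y : Option α) : Prop := rank l x < rank l y

instance {α : Type*} [DecidableEq α] (l : List α) (x y : Option α) : Decidable (Prefers l x y) :=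
  inferInstanceAs (Decidable (rank l x < rank l y))

/-! ### Matchings

A set of edges in which every resident has at most one hospital is given by the function
`M : R → Option H` that sends a resident to its hospital, or to `none` when it is unmatched. -/

/-- The set `M(h)` of residents that are assigned to `h`. -/
def assigned (M : R → Option H) (h : H) : Finset R := Finset.univ.filter fun r => M r = some h

/-- `M` is a matching: it uses edges only and respects the upper quotas. -/
def IsMatching (G : HRLQ R H) (M : R → Option H) : Prop :=
  (∀ r h, M r = some h → G.Edge r h) ∧ ∀ h, (assigned M h).card ≤ G.upper h

/-- `M` is a feasible matching: it respects the lower quotas, too. -/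
def IsFeasible (G : HRLQ R H) (M : R → Option H) : Prop :=
  G.IsMatching M ∧ ∀ h, G.lower h ≤ (assigned M h).card

/-- The pair `(r, h)` blocks `M`. -/
def Blocks (G : HRLQ R H) (M : R → Option H) (r : R) (h : H) : Prop :=
  G.Edge r h ∧ M r ≠ some h ∧
    (M r = none ∨ ∃ h', M r = some h' ∧ Prefers (G.resList r) (some h) (some h')) ∧
    ((assigned M h).card < G.upper h ∨
      ∃ r' ∈ assigned M h, Prefers (G.hosList h) (some r) (some r'))

/-- `M` is a stable matching. -/
def IsStable (G : HRLQ R H) (M : R → Option H) : Prop :=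
  G.IsMatching M ∧ ∀ r h, ¬ G.Blocks M r h

/-! ### Votes and popularity -/

/-- The vote between `x` and `y` of a vertex with preference list `l`. -/
def vote {α : Type*} [DecidableEq α] (l : List α) (x y : Option α) : ℤ :=
  if Prefers l x y then 1 else if Prefers l y x then -1 else 0

/-- The `q⁺(h)` places of the hospital `h` under `M`: the residents in `M(h)`, the remaining places
being filled up with copies of `none`. -/
def places (G : HRLQ R H) (M : R → Option H) (h : H) : Multiset (Option R) :=
  (assigned M h).val.map some + Multiset.replicate (G.upper h - (assigned M h).card) none

/-- A choice of the functions `corr`: `corr M M' h` is the collection of pairs `(x, corr_h(x, M, M'))`. -/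
abbrev Corr (R H : Type*) := (R → Option H) → (R → Option H) → H → Multiset (Option R × Option R)

/-- Whenever `M` and `M'` are matchings, `corr M M' h` is a one-to-one pairing of the places of `h`
in `M(h) \ M'(h)` with those in `M'(h) \ M(h)` (differences of multisets: the entries that the two
collections of places have in common are dropped, with multiplicity). -/
def IsCorr (G : HRLQ R H) (corr : Corr R H) : Prop :=
  ∀ M M' : R → Option H, G.IsMatching M → G.IsMatching M' → ∀ h,
    (corr M M' h).map Prod.fst = G.places M h - G.places M' h ∧
    (corr M M' h).map Prod.snd = G.places M' h - G.places M h

/-- The vote of the resident `r` between `M` and `M'`. -/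
def resVote (G : HRLQ R H) (M M' : R → Option H) (r : R) : ℤ := vote (G.resList r) (M r) (M' r)

/-- The sum of the votes of the hospital `h` between `M` and `M'`. -/
def hosVote (G : HRLQ R H) (corr : Corr R H) (M M' : R → Option H) (h : H) : ℤ :=
  ((corr M M' h).map fun p => vote (G.hosList h) p.1 p.2).sum

/-- The sum of all the votes between `M` and `M'`. -/
def totalVote (G : HRLQ R H) (corr : Corr R H) (M M' : R → Option H) : ℤ :=
  ∑ r, G.resVote M M' r + ∑ h, G.hosVote corr M M' h

/-- `M` is more popular than `M'`. -/
def MorePopular (G : HRLQ R H) (corr : Corr R H) (M M' : R → Option H) : Prop :=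
  G.totalVote corr M' M < G.totalVote corr M M'

/-- `M` is popular amongst the feasible matchings. -/
def IsPopularAmongFeasible (G : HRLQ R H) (corr : Corr R H) (M : R → Option H) : Prop :=
  G.IsFeasible M ∧ ∀ M', G.IsFeasible M' → ¬ G.MorePopular corr M' M

/-! ### The level-based hospital-proposing algorithm -/

/-- The variables of the algorithm. -/
structure State (R H : Type*) where
  /-- the current matching `M` -/
  matching : R → Option H
  /-- the queue `Q` of hospitals -/
  queue : List H
  /-- the levels of the hospitals -/
  hosLevel : H → ℕ
  /-- the levels of the residents -/
  resLevel : R → ℤ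
  /-- `proposed h i` is the set of residents to whom `h` has proposed with level `i` -/
  proposed : H → ℕ → Finset R

/-- The initial state, the hospitals being put into the queue in the order of the list `order`. -/
def State.init (order : List H) : State R H where
  matching _ := none
  queue := order
  hosLevel _ := 0
  resLevel _ := -1
  proposed _ _ := ∅

/-- Add `h` at the end of the queue, unless it is there already. -/
def enqueue (q : List H) (h : H) : List H := if h ∈ q then q else q ++ [h]

/-- The residents on the list of `h` to whom `h` has not yet proposed with its current level,
in the order of preference of `h`. -/
def remaining (G : HRLQ R H) (s : State R H) (h : H) : List R :=
  (G.hosList h).filter fun r => r ∉ s.proposed h (s.hosLevel h)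

/-- The test `pref(r, h, h') = 1`, by which a resident `r` who is matched to `h'`
accepts a proposal of `h`. -/
def Accepts (G : HRLQ R H) (s : State R H) (r : R) (h h' : H) : Prop :=
  s.resLevel r < s.hosLevel h ∨
    (s.resLevel r = s.hosLevel h ∧ Prefers (G.resList r) (some h) (some h'))

instance (G : HRLQ R H) (s : State R H) (r : R) (h h' : H) : Decidable (G.Accepts s r h h') :=
  inferInstanceAs (Decidable (_ ∨ _))

/-- `h` takes part in the proposals again after it was given a resident: either it has level `0`
and a free place, or it is a lower-quota hospital and its lower quota is not met. -/
def Continues (G : HRLQ R H) (s : State R H) (h : H) : Prop :=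
  (s.hosLevel h = 0 ∧ (assigned s.matching h).card < G.upper h) ∨
    (0 < G.lower h ∧ (assigned s.matching h).card < G.lower h)

instance (G : HRLQ R H) (s : State R H) (h : H) : Decidable (G.Continues s h) :=
  inferInstanceAs (Decidable (_ ∨ _))

/-- The hospital `h` is given the resident `r` (who leaves its previous hospital), the level of `r`
becomes that of `h`, and `h` is added to the queue if it still has to propose. -/
def assign (G : HRLQ R H) (s : State R H) (r : R) (h : H) : State R H :=
  let t : State R H :=
    { s with
      matching := Function.update s.matching r (some h)
      resLevel := Function.update s.resLevel r (s.hosLevel h) }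
  if G.Continues t h then { t with queue := enqueue t.queue h } else t

/-- The hospital `h` proposes to the resident `r`. -/
def propose (G : HRLQ R H) (s : State R H) (r : R) (h : H) : State R H :=
  let t : State R H :=
    { s with
      proposed := Function.update s.proposed h
        (Function.update (s.proposed h) (s.hosLevel h) (insert r (s.proposed h (s.hosLevel h)))) }
  match t.matching r with
  | none => G.assign t r h
  | some h' =>
    if G.Accepts t r h h' then G.assign { t with queue := enqueue t.queue h' } r h
    else { t with queue := enqueue t.queue h }

/-- The case in which `h` has proposed to its whole list with its current level: if the lower quota
of `h` is not met and the level of `h` is less than the number of residents, then `h` goes up by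
one level and is added to the queue. -/
def exhaust (G : HRLQ R H) (s : State R H) (h : H) : State R H :=
  if 0 < G.lower h ∧ (assigned s.matching h).card < G.lower h ∧ s.hosLevel h < Fintype.card R then
    { s with
      hosLevel := Function.update s.hosLevel h (s.hosLevel h + 1)
      queue := enqueue s.queue h }
  else s

/-- One round of the main loop: the first hospital is removed from the queue and proposes to the
most preferred resident that remains for it. A state whose queue is empty is left as it is. -/
def step (G : HRLQ R H) (s : State R H) : State R H :=
  match s.queue with
  | [] => s
  | h :: q =>
    match G.remaining s h with
    | r :: _ => G.propose { s with queue := q } r h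
    | [] => G.exhaust { s with queue := q } h

/-- The algorithm, started with the hospitals queued in the order `order`, stops after finitely
many rounds (with an empty queue) and returns `M`. -/
def Outputs (G : HRLQ R H) (order : List H) (M : R → Option H) : Prop :=
  ∃ n : ℕ, (G.step^[n] (State.init order)).queue = [] ∧
    (G.step^[n] (State.init order)).matching = M

end HRLQ

set_option linter.unusedSectionVars false

namespace HRLQ

variable {R H : Type*} [Fintype R] [Fintype H] [DecidableEq R] [DecidableEq H]

/-! ### Queues, assigned residents and proposals -/

/-! Two invariants describe the run. `Consistent` records deferred acceptance with levels: a
resident only ever trades up, first in level and then in preference, and at each level a hospital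
works down a prefix of its list. `QueueConsistent` records that a hospital fills up to its upper
quota at level 0 but only to its lower quota above, and why a hospital is idle.

Feasibility is a counting argument. A hospital left deficient must have climbed to level
`Fintype.card R`, and then every level below is the exact level of some resident
(`residentsFrom_succ_ssubset`), since otherwise the hospitals above that level would demand more
residents than their neighbourhood contains. That uses up all residents, yet some neighbour of the
hospital has the top level.

Popularity is a dual-price argument. Each resident is priced at twice its level; the factor 2 lets
one level outweigh a vote of the resident and a vote of the hospital together. Every pair `(x, y)`
of a correspondence satisfies vote ≤ `gain x - loss y`, whatever the pairing (`vote_some_some_le`,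
`vote_some_none_le`, `vote_none_some_le`). Summed over all hospitals and regrouped by resident,
prices and resident votes cancel (`votes_nonpos`).

If a feasible stable `S` exists, no resident ever turns away its `S`-partner, so no hospital leaves
level 0 (`LevelZero.step`) and the run is ordinary hospital-proposing Gale–Shapley. -/

theorem mem_enqueue {q : List H} {h x : H} : x ∈ enqueue q h ↔ x ∈ q ∨ x = h := by
  unfold enqueue
  split_ifs with hq
  · exact ⟨Or.inl, fun hx => hx.elim id fun e => e ▸ hq⟩
  · simp

theorem nodup_enqueue {q : List H} (hq : q.Nodup) (h : H) : (enqueue q h).Nodup := by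
  unfold enqueue
  split_ifs with hh
  · exact hq
  · rw [List.nodup_append]
    refine ⟨hq, List.nodup_singleton h, fun a ha b hb e => hh ?_⟩
    rw [List.mem_singleton] at hb
    exact hb ▸ e ▸ ha

theorem length_enqueue_le (q : List H) (h : H) : (enqueue q h).length ≤ q.length + 1 := by
  unfold enqueue
  split_ifs <;> simp

theorem mem_assigned {M : R → Option H} {h : H} {r : R} : r ∈ assigned M h ↔ M r = some h := by
  simp [assigned]

theorem assigned_update_self (M : R → Option H) (r : R) (h : H) :
    assigned (Function.update M r (some h)) h = insert r (assigned M h) := by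
  ext x
  by_cases hx : x = r
  · subst hx; simp [mem_assigned]
  · simp [mem_assigned, hx]

theorem assigned_update_of_ne (M : R → Option H) (r : R) {h h₀ : H} (hne : h₀ ≠ h) :
    assigned (Function.update M r (some h)) h₀ = (assigned M h₀).erase r := by
  ext x
  by_cases hx : x = r
  · subst hx; simp [mem_assigned, hne.symm]
  · simp [mem_assigned, hx]

/-- The record of the proposals after `h` has proposed to `r`. -/
def markProposed (s : State R H) (h : H) (r : R) : H → ℕ → Finset R :=
  Function.update s.proposed h
    (Function.update (s.proposed h) (s.hosLevel h) (insert r (s.proposed h (s.hosLevel h))))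

theorem mem_markProposed {s : State R H} {h h₀ : H} {r x : R} {i : ℕ} :
    x ∈ markProposed s h r h₀ i ↔
      x ∈ s.proposed h₀ i ∨ (h₀ = h ∧ i = s.hosLevel h ∧ x = r) := by
  unfold markProposed
  by_cases hh : h₀ = h
  · subst hh
    by_cases hi : i = s.hosLevel h₀
    · subst hi; simp [or_comm]
    · simp [hi]
  · simp [hh]

theorem remaining_eq_nil {G : HRLQ R H} {s : State R H} {h : H} :
    G.remaining s h = [] ↔ ∀ r ∈ G.hosList h, r ∈ s.proposed h (s.hosLevel h) := by
  simp [remaining, List.filter_eq_nil_iff]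

theorem remaining_eq_cons {G : HRLQ R H} {s : State R H} {h : H} {r : R} {l : List R}
    (hr : G.remaining s h = r :: l) :
    r ∈ G.hosList h ∧ r ∉ s.proposed h (s.hosLevel h) ∧
      ∀ x ∈ G.hosList h, (G.hosList h).idxOf x < (G.hosList h).idxOf r →
        x ∈ s.proposed h (s.hosLevel h) := by
  unfold remaining at hr
  obtain ⟨l₁, l₂, hl, h₁, hp, -⟩ := List.filter_eq_cons_iff.1 hr
  refine ⟨by simp [hl], by simpa using hp, fun x _ hlt => ?_⟩
  have hx : x ∈ l₁ := by
    by_contra hx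
    rw [hl, List.idxOf_append_of_notMem hx] at hlt
    have : (l₁ ++ r :: l₂).idxOf r ≤ l₁.length := by
      by_cases hr₁ : r ∈ l₁
      · rw [List.idxOf_append_of_mem hr₁]; exact List.idxOf_le_length
      · rw [List.idxOf_append_of_notMem hr₁]; simp
    omega
  simpa using h₁ x hx

/-- The four possible effects of a round. -/
theorem step_induction (G : HRLQ R H) {s : State R H} {h : H} {q : List H} (hq : s.queue = h :: q)
    {P : State R H → Prop}
    (reject : ∀ r l h', G.remaining s h = r :: l → s.matching r = some h' → ¬ G.Accepts s r h h' →
      P ⟨s.matching, enqueue q h, s.hosLevel, s.resLevel, markProposed s h r⟩)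
    (accept : ∀ r l q', G.remaining s h = r :: l →
      (∀ h', s.matching r = some h' → G.Accepts s r h h') →
      (∀ x, x ∈ q' ↔ x ∈ q ∨ s.matching r = some x ∨ (x = h ∧
        ((s.hosLevel h = 0 ∧ (insert r (assigned s.matching h)).card < G.upper h) ∨
          (0 < G.lower h ∧ (insert r (assigned s.matching h)).card < G.lower h)))) →
      (q.Nodup → q'.Nodup) → q'.length ≤ q.length + 2 →
      P ⟨Function.update s.matching r (some h), q', s.hosLevel,
        Function.update s.resLevel r (s.hosLevel h), markProposed s h r⟩)
    (raise : G.remaining s h = [] → 0 < G.lower h →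
      (assigned s.matching h).card < G.lower h → s.hosLevel h < Fintype.card R →
      P ⟨s.matching, enqueue q h, Function.update s.hosLevel h (s.hosLevel h + 1), s.resLevel,
        s.proposed⟩)
    (halt : G.remaining s h = [] →
      ¬ (0 < G.lower h ∧ (assigned s.matching h).card < G.lower h ∧
        s.hosLevel h < Fintype.card R) →
      P ⟨s.matching, q, s.hosLevel, s.resLevel, s.proposed⟩) :
    P (G.step s) := by
  unfold step
  rw [hq]
  dsimp only
  cases hr : G.remaining s h with
  | nil =>
    dsimp only
    unfold exhaust
    split_ifs with hc
    · exact raise hr hc.1 hc.2.1 hc.2.2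
    · exact halt hr hc
  | cons r l =>
    dsimp only
    unfold propose
    dsimp only
    cases hm : s.matching r with
    | none =>
      dsimp only
      unfold assign
      dsimp only
      split_ifs with hc
      · refine accept r l _ hr (by simp [hm]) (fun x => ?_) (fun hn => nodup_enqueue hn _)
          ((length_enqueue_le _ _).trans (by omega))
        simp only [Continues, assigned_update_self] at hc
        rw [mem_enqueue, hm]
        simp [hc]
      · refine accept r l _ hr (by simp [hm]) (fun x => ?_) id (by simp)
        simp only [Continues, assigned_update_self] at hc
        rw [hm]
        simp [hc]
    | some h' =>
      dsimp only
      split_ifs with ha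
      · have ha' : ∀ h'', s.matching r = some h'' → G.Accepts s r h h'' := by
          intro h'' e
          rw [hm] at e
          obtain rfl := Option.some.inj e
          exact ha
        unfold assign
        dsimp only
        split_ifs with hc
        · refine accept r l _ hr ha' (fun x => ?_)
            (fun hn => nodup_enqueue (nodup_enqueue hn _) _)
            ((length_enqueue_le _ _).trans (Nat.succ_le_succ (length_enqueue_le _ _)))
          simp only [Continues, assigned_update_self] at hc
          rw [mem_enqueue, mem_enqueue, hm]
          simp [hc, or_assoc, @eq_comm _ x h']
        · refine accept r l _ hr ha' (fun x => ?_) (fun hn => nodup_enqueue hn _)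
            ((length_enqueue_le _ _).trans (by omega))
          simp only [Continues, assigned_update_self] at hc
          rw [mem_enqueue, hm]
          simp [hc, @eq_comm _ x h']
      · exact reject r l h' hr hm ha

/-! ### Invariants -/

/-- The facts about levels, proposals and the matching that hold during the whole run. -/
structure Consistent (G : HRLQ R H) (s : State R H) : Prop where
  level_le : ∀ h, s.hosLevel h ≤ Fintype.card R
  of_none : ∀ r, s.matching r = none → s.resLevel r = -1
  of_some : ∀ r h, s.matching r = some h →
    ∃ i ≤ s.hosLevel h, r ∈ s.proposed h i ∧ s.resLevel r = i
  mem_list : ∀ r h i, r ∈ s.proposed h i → r ∈ G.hosList h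
  level_of_proposed : ∀ r h i, r ∈ s.proposed h i → i ≤ s.hosLevel h
  answer : ∀ r h i, r ∈ s.proposed h i → ∃ h', s.matching r = some h' ∧
    ((i : ℤ) < s.resLevel r ∨
      ((i : ℤ) = s.resLevel r ∧ rank (G.resList r) (some h') ≤ rank (G.resList r) (some h)))
  proposed_of_lt : ∀ h i, i < s.hosLevel h → ∀ r ∈ G.hosList h, r ∈ s.proposed h i
  proposed_of_idxOf_lt : ∀ r h, r ∈ s.proposed h (s.hosLevel h) → ∀ x ∈ G.hosList h,
    (G.hosList h).idxOf x < (G.hosList h).idxOf r → x ∈ s.proposed h (s.hosLevel h)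

theorem Consistent.init (G : HRLQ R H) (order : List H) :
    G.Consistent (State.init order : State R H) := by
  constructor <;> simp [State.init]

/-- The delicate field is `answer`. It survives because accepting a proposal either raises the level
of the resident or keeps it and improves the partner, so earlier answers stay justified. -/
theorem Consistent.step {G : HRLQ R H} {s : State R H} (hs : G.Consistent s) :
    G.Consistent (G.step s) := by
  cases hq : s.queue with
  | nil => simpa [HRLQ.step, hq] using hs
  | cons h q =>
    refine step_induction G hq ?_ ?_ ?_ ?_
    · intro r l h' hr hm ha
      obtain ⟨hrl, hrp, hpre⟩ := remaining_eq_cons hr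
      refine ⟨hs.level_le, hs.of_none, ?_, ?_, ?_, ?_, ?_, ?_⟩
      · intro x h₀ hx
        obtain ⟨i, hi, hxi, e⟩ := hs.of_some x h₀ hx
        exact ⟨i, hi, mem_markProposed.2 (Or.inl hxi), e⟩
      · intro x h₀ i hx
        rcases mem_markProposed.1 hx with hx | ⟨rfl, rfl, rfl⟩
        exacts [hs.mem_list _ _ _ hx, hrl]
      · intro x h₀ i hx
        rcases mem_markProposed.1 hx with hx | ⟨rfl, rfl, rfl⟩
        exacts [hs.level_of_proposed _ _ _ hx, le_rfl]
      · intro x h₀ i hx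
        rcases mem_markProposed.1 hx with hx | ⟨rfl, rfl, rfl⟩
        · exact hs.answer _ _ _ hx
        · refine ⟨h', hm, ?_⟩
          unfold Accepts Prefers at ha
          push Not at ha
          rcases ha.1.lt_or_eq with hlt | e
          · exact Or.inl hlt
          · exact Or.inr ⟨e, ha.2 e.symm⟩
      · intro h₀ i hi x hx
        exact mem_markProposed.2 (Or.inl (hs.proposed_of_lt h₀ i hi x hx))
      · intro x h₀ hx y hy hlt
        rcases mem_markProposed.1 hx with hx | ⟨rfl, -, rfl⟩
        · exact mem_markProposed.2 (Or.inl (hs.proposed_of_idxOf_lt x h₀ hx y hy hlt))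
        · exact mem_markProposed.2 (Or.inl (hpre y hy hlt))
    · intro r l q' hr ha _ _ _
      obtain ⟨hrl, hrp, hpre⟩ := remaining_eq_cons hr
      refine ⟨hs.level_le, ?_, ?_, ?_, ?_, ?_, ?_, ?_⟩
      · intro x hx
        by_cases hxr : x = r
        · subst hxr; simp at hx
        · simp only [Function.update_of_ne hxr] at hx ⊢
          exact hs.of_none x hx
      · intro x h₀ hx
        by_cases hxr : x = r
        · subst hxr
          obtain rfl : h = h₀ := by simpa using hx
          exact ⟨s.hosLevel h, le_rfl, mem_markProposed.2 (Or.inr ⟨rfl, rfl, rfl⟩), by simp⟩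
        · simp only [Function.update_of_ne hxr] at hx ⊢
          obtain ⟨i, hi, hxi, e⟩ := hs.of_some x h₀ hx
          exact ⟨i, hi, mem_markProposed.2 (Or.inl hxi), e⟩
      · intro x h₀ i hx
        rcases mem_markProposed.1 hx with hx | ⟨rfl, rfl, rfl⟩
        exacts [hs.mem_list _ _ _ hx, hrl]
      · intro x h₀ i hx
        rcases mem_markProposed.1 hx with hx | ⟨rfl, rfl, rfl⟩
        exacts [hs.level_of_proposed _ _ _ hx, le_rfl]
      · intro x h₀ i hx
        rcases mem_markProposed.1 hx with hx | ⟨rfl, rfl, rfl⟩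
        · obtain ⟨h', hm, hans⟩ := hs.answer _ _ _ hx
          by_cases hxr : x = r
          · subst hxr
            refine ⟨h, by simp, ?_⟩
            simp only [Function.update_self]
            rcases ha h' hm with hlt | ⟨e, hp⟩
            · left
              rcases hans with h1 | h1
              · exact h1.trans hlt
              · exact h1.1 ▸ hlt
            · rcases hans with h1 | h1
              · exact Or.inl (e ▸ h1)
              · exact Or.inr ⟨h1.1.trans e, (le_of_lt hp).trans h1.2⟩
          · simp only [Function.update_of_ne hxr]
            exact ⟨h', hm, hans⟩
        · exact ⟨h₀, by simp, Or.inr ⟨by simp, le_rfl⟩⟩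
      · intro h₀ i hi x hx
        exact mem_markProposed.2 (Or.inl (hs.proposed_of_lt h₀ i hi x hx))
      · intro x h₀ hx y hy hlt
        rcases mem_markProposed.1 hx with hx | ⟨rfl, -, rfl⟩
        · exact mem_markProposed.2 (Or.inl (hs.proposed_of_idxOf_lt x h₀ hx y hy hlt))
        · exact mem_markProposed.2 (Or.inl (hpre y hy hlt))
    · intro hr hl hc hlev
      have hle : ∀ h₀, s.hosLevel h₀ ≤ Function.update s.hosLevel h (s.hosLevel h + 1) h₀ := by
        intro h₀
        by_cases e : h₀ = h
        · subst e; simp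
        · simp [e]
      refine ⟨?_, hs.of_none, ?_, hs.mem_list, ?_, hs.answer, ?_, ?_⟩
      · intro h₀
        by_cases e : h₀ = h
        · subst e; simpa using hlev
        · simpa [e] using hs.level_le h₀
      · intro x h₀ hx
        obtain ⟨i, hi, hxi⟩ := hs.of_some x h₀ hx
        exact ⟨i, hi.trans (hle h₀), hxi⟩
      · intro x h₀ i hx
        exact (hs.level_of_proposed x h₀ i hx).trans (hle h₀)
      · intro h₀ i hi x hx
        by_cases e : h₀ = h
        · subst e
          simp only [Function.update_self] at hi
          rcases Nat.lt_succ_iff_lt_or_eq.1 hi with hi | rfl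
          · exact hs.proposed_of_lt _ _ hi x hx
          · exact remaining_eq_nil.1 hr x hx
        · exact hs.proposed_of_lt _ _ (by simpa [e] using hi) x hx
      · intro x h₀ hx y hy hlt
        by_cases e : h₀ = h
        · subst e
          simp only [Function.update_self] at hx
          -- Nothing has been proposed yet at the new level, so the prefix condition is vacuous
          -- there.
          have := hs.level_of_proposed _ _ _ hx
          omega
        · simp only [Function.update_of_ne e] at hx ⊢
          exact hs.proposed_of_idxOf_lt x h₀ hx y hy hlt
    · intro _ _
      exact ⟨hs.level_le, hs.of_none, hs.of_some, hs.mem_list, hs.level_of_proposed, hs.answer,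
        hs.proposed_of_lt, hs.proposed_of_idxOf_lt⟩

/-- The number of residents that `h` may hold at the given level: its upper quota at level `0`,
its lower quota at the other levels. -/
def capacity (G : HRLQ R H) (h : H) (i : ℕ) : ℕ := if i = 0 then G.upper h else G.lower h

/-- The facts about the queue that hold during the whole run. -/
structure QueueConsistent (G : HRLQ R H) (s : State R H) : Prop where
  nodup : s.queue.Nodup
  card_le : ∀ h, (assigned s.matching h).card ≤ G.capacity h (s.hosLevel h)
  card_lt : ∀ h ∈ s.queue, (assigned s.matching h).card < G.capacity h (s.hosLevel h)
  of_notMem : ∀ h, h ∉ s.queue →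
    (assigned s.matching h).card = G.capacity h (s.hosLevel h) ∨
      ((∀ r ∈ G.hosList h, r ∈ s.proposed h (s.hosLevel h)) ∧
        (G.lower h ≤ (assigned s.matching h).card ∨ s.hosLevel h = Fintype.card R))

theorem QueueConsistent.init (G : HRLQ R H) {order : List H} (hn : order.Nodup)
    (hall : ∀ h, h ∈ order) : G.QueueConsistent (State.init order : State R H) := by
  refine ⟨hn, ?_, ?_, fun h hh => absurd (hall h) hh⟩
  · simp [State.init, assigned]
  · simp [State.init, assigned, capacity, G.upper_pos]

/-- Losing a resident drops a hospital strictly below capacity exactly when it is requeued, and the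
requeueing test after a gain is the comparison with `capacity`. -/
theorem QueueConsistent.step {G : HRLQ R H} (hG : ∀ h, G.lower h ≤ G.upper h) {s : State R H}
    (hc : G.Consistent s) (hs : G.QueueConsistent s) : G.QueueConsistent (G.step s) := by
  cases hq : s.queue with
  | nil => simpa [HRLQ.step, hq] using hs
  | cons h q =>
    have hn : h ∉ q ∧ q.Nodup := by simpa [hq] using hs.nodup
    have hlt := hs.card_lt h (by simp [hq])
    have hltq : ∀ x ∈ q, (assigned s.matching x).card < G.capacity x (s.hosLevel x) :=
      fun x hx => hs.card_lt x (by simp [hq, hx])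
    refine step_induction G hq ?_ ?_ ?_ ?_
    · intro r l h' hr hm ha
      refine ⟨nodup_enqueue hn.2 h, hs.card_le, ?_, ?_⟩
      · intro x hx
        rcases mem_enqueue.1 hx with hx | rfl
        exacts [hltq x hx, hlt]
      · intro x hx
        rw [mem_enqueue, not_or] at hx
        rcases hs.of_notMem x (by simp [hq, hx]) with h1 | ⟨h1, h2⟩
        · exact Or.inl h1
        · exact Or.inr ⟨fun y hy => mem_markProposed.2 (Or.inl (h1 y hy)), h2⟩
    · intro r l q' hr ha hq' hnd _
      have hins : (insert r (assigned s.matching h)).card ≤ G.capacity h (s.hosLevel h) :=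
        (Finset.card_insert_le _ _).trans hlt
      refine ⟨hnd hn.2, ?_, ?_, ?_⟩
      · intro x
        by_cases hx : x = h
        · subst hx
          simpa only [assigned_update_self] using hins
        · simp only [assigned_update_of_ne _ _ hx]
          exact (Finset.card_erase_le).trans (hs.card_le x)
      · intro x hx
        by_cases hxh : x = h
        · subst hxh
          simp only [assigned_update_self]
          rcases (hq' x).1 hx with h1 | h1 | ⟨-, h1 | h1⟩
          · exact absurd h1 hn.1
          -- The resident already belonged to the proposing hospital, at a lower level: the hospital
          -- requeues itself and its set of residents does not change.
          · rw [Finset.insert_eq_of_mem (mem_assigned.2 h1)]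
            exact hlt
          · simpa [capacity, h1.1] using h1.2
          · refine h1.2.trans_le ?_
            unfold capacity
            split_ifs
            exacts [hG x, le_rfl]
        · simp only [assigned_update_of_ne _ _ hxh]
          rcases (hq' x).1 hx with h1 | h1 | ⟨h1, -⟩
          · exact (Finset.card_erase_le).trans_lt (hltq x h1)
          · exact (Finset.card_erase_lt_of_mem (mem_assigned.2 h1)).trans_le (hs.card_le x)
          · exact absurd h1 hxh
      · intro x hx
        rw [hq', not_or, not_or] at hx
        by_cases hxh : x = h
        · subst hxh
          simp only [assigned_update_self]
          refine Or.inl (le_antisymm hins ?_)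
          obtain ⟨-, -, hx⟩ := hx
          simp only [true_and, not_or, not_and, not_lt] at hx
          unfold capacity
          split_ifs with h0
          · exact hx.1 h0
          · rcases Nat.eq_zero_or_pos (G.lower x) with h1 | h1
            · omega
            · exact hx.2 h1
        · have hxr : r ∉ assigned s.matching x := fun h1 => hx.2.1 (mem_assigned.1 h1)
          simp only [assigned_update_of_ne _ _ hxh, Finset.erase_eq_of_notMem hxr]
          rcases hs.of_notMem x (by simp [hq, hx, hxh]) with h1 | ⟨h1, h2⟩
          · exact Or.inl h1
          · exact Or.inr ⟨fun y hy => mem_markProposed.2 (Or.inl (h1 y hy)), h2⟩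
    · intro hr hl hcl hlev
      -- Leaving level 0 may shrink the capacity from the upper to the lower quota; this is harmless
      -- because only a deficient hospital goes up.
      have key : (assigned s.matching h).card < G.capacity h (s.hosLevel h + 1) := by
        simpa [capacity] using hcl
      refine ⟨nodup_enqueue hn.2 h, ?_, ?_, ?_⟩
      · intro x
        by_cases hx : x = h
        · subst hx
          simpa only [Function.update_self] using key.le
        · simpa only [Function.update_of_ne hx] using hs.card_le x
      · intro x hx
        by_cases hxh : x = h
        · subst hxh
          simpa only [Function.update_self] using key
        · simp only [Function.update_of_ne hxh]
          rw [mem_enqueue] at hx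
          exact hltq x (hx.resolve_right hxh)
      · intro x hx
        rw [mem_enqueue, not_or] at hx
        simp only [Function.update_of_ne hx.2]
        exact hs.of_notMem x (by simp [hq, hx])
    · intro hr hcl
      refine ⟨hn.2, hs.card_le, hltq, ?_⟩
      intro x hx
      by_cases hxh : x = h
      · subst hxh
        refine Or.inr ⟨remaining_eq_nil.1 hr, ?_⟩
        have := hc.level_le x
        dsimp only
        omega
      · exact hs.of_notMem x (by simp [hq, hx, hxh])

/-! ### Termination -/

/-- The triples of a hospital, a level and a resident that have not been used for a proposal. -/
def pending (s : State R H) : Finset (H × Fin (Fintype.card R + 1) × R) :=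
  Finset.univ.filter fun p => p.2.2 ∉ s.proposed p.1 p.2.1

/-- A quantity that decreases in every round. -/
def potential (s : State R H) : ℕ :=
  2 * (pending s).card + ∑ h, (Fintype.card R - s.hosLevel h) + s.queue.length

theorem card_pending_lt {s t : State R H} {h : H} {r : R} (hl : s.hosLevel h ≤ Fintype.card R)
    (hr : r ∉ s.proposed h (s.hosLevel h)) (ht : t.proposed = markProposed s h r) :
    (pending t).card < (pending s).card := by
  refine Finset.card_lt_card ((Finset.ssubset_iff_of_subset ?_).2
    ⟨(h, ⟨s.hosLevel h, by omega⟩, r), ?_, ?_⟩)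
  · intro p
    simp only [pending, Finset.mem_filter_univ, ht]
    exact fun hp hp' => hp (mem_markProposed.2 (Or.inl hp'))
  · simpa [pending] using hr
  · simp [pending, ht, mem_markProposed]

/-- A proposal uses up a pending triple, worth 2, while the queue grows by at most 1: one hospital
is removed and at most two are added. A level rise leaves the queue length at most the same and
lowers the level sum; otherwise only the queue shrinks. -/
theorem potential_step_lt {G : HRLQ R H} {s : State R H} (hs : G.Consistent s)
    (hq : s.queue ≠ []) : potential (G.step s) < potential s := by
  cases hq' : s.queue with
  | nil => exact absurd hq' hq
  | cons h q =>
    refine step_induction G hq' (P := fun t => potential t < potential s) ?_ ?_ ?_ ?_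
    · intro r l h' hr hm ha
      have h1 := card_pending_lt (t := ⟨s.matching, enqueue q h, s.hosLevel, s.resLevel,
        markProposed s h r⟩) (hs.level_le h) (remaining_eq_cons hr).2.1 rfl
      have h2 := length_enqueue_le q h
      simp only [potential, hq', List.length_cons]
      omega
    · intro r l q' hr _ _ _ h2
      have h1 := card_pending_lt (t := ⟨Function.update s.matching r (some h), q', s.hosLevel,
        Function.update s.resLevel r (s.hosLevel h), markProposed s h r⟩)
        (hs.level_le h) (remaining_eq_cons hr).2.1 rfl
      simp only [potential, hq', List.length_cons]
      omega
    · intro _ _ _ hlev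
      have h2 := length_enqueue_le q h
      have h1 : ∑ x, (Fintype.card R - Function.update s.hosLevel h (s.hosLevel h + 1) x) <
          ∑ x, (Fintype.card R - s.hosLevel x) := by
        refine Finset.sum_lt_sum (fun x _ => ?_) ⟨h, Finset.mem_univ h, ?_⟩
        · by_cases e : x = h
          · subst e; simp only [Function.update_self]; omega
          · simp [e]
        · simp only [Function.update_self]; omega
      have h3 : pending (⟨s.matching, enqueue q h, Function.update s.hosLevel h (s.hosLevel h + 1),
        s.resLevel, s.proposed⟩ : State R H) = pending s := rfl
      simp only [potential, hq', List.length_cons, h3]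
      omega
    · intro _ _
      simp [potential, hq', pending]

theorem Consistent.exists_queue_eq_nil {G : HRLQ R H} {s : State R H} (hs : G.Consistent s) :
    ∃ n, (G.step^[n] s).queue = [] := by
  induction hk : potential s using Nat.strong_induction_on generalizing s with
  | _ k ih =>
    by_cases hq : s.queue = []
    · exact ⟨0, hq⟩
    · obtain ⟨n, hn⟩ := ih _ (hk ▸ potential_step_lt hs hq) hs.step rfl
      exact ⟨n + 1, hn⟩

theorem Consistent.iterate {G : HRLQ R H} {s : State R H} (hs : G.Consistent s) (n : ℕ) :
    G.Consistent (G.step^[n] s) := by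
  induction n with
  | zero => exact hs
  | succ n ih => rw [Function.iterate_succ_apply']; exact ih.step

theorem QueueConsistent.iterate {G : HRLQ R H} (hG : ∀ h, G.lower h ≤ G.upper h)
    {s : State R H} (hc : G.Consistent s) (hs : G.QueueConsistent s) (n : ℕ) :
    G.QueueConsistent (G.step^[n] s) := by
  induction n with
  | zero => exact hs
  | succ n ih => rw [Function.iterate_succ_apply']; exact ih.step hG (hc.iterate n)


/-! ### Feasibility of the output -/

theorem Consistent.edge {G : HRLQ R H} {s : State R H} (hs : G.Consistent s) {r : R} {h : H}
    (hm : s.matching r = some h) : G.Edge r h := by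
  obtain ⟨i, -, hi, -⟩ := hs.of_some r h hm
  exact (G.mutual_acceptable r h).2 (hs.mem_list r h i hi)

theorem Consistent.le_resLevel {G : HRLQ R H} {s : State R H} (hs : G.Consistent s)
    {r : R} {h : H} {i : ℕ} (hr : r ∈ s.proposed h i) : (i : ℤ) ≤ s.resLevel r := by
  obtain ⟨_, -, hlt | ⟨heq, -⟩⟩ := hs.answer r h i hr
  exacts [hlt.le, heq.le]

theorem QueueConsistent.isMatching {G : HRLQ R H} (hG : ∀ h, G.lower h ≤ G.upper h)
    {s : State R H} (hc : G.Consistent s) (hs : G.QueueConsistent s) : G.IsMatching s.matching := by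
  refine ⟨fun r h hm => hc.edge hm, fun h => (hs.card_le h).trans ?_⟩
  unfold capacity
  split_ifs
  exacts [le_rfl, hG h]

/-- A set of hospitals whose neighbours all lie in `T` needs at most `#T` residents. -/
theorem sum_lower_le_card {G : HRLQ R H} {N : R → Option H} (hN : G.IsFeasible N) (S : Finset H)
    (T : Finset R) (hT : ∀ h ∈ S, ∀ r, G.Edge r h → r ∈ T) : ∑ h ∈ S, G.lower h ≤ T.card := by
  refine (Finset.sum_le_sum fun h _ => hN.2 h).trans ?_
  rw [← Finset.card_biUnion]
  · refine Finset.card_le_card fun r hr => ?_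
    obtain ⟨h, hh, hr⟩ := Finset.mem_biUnion.1 hr
    exact hT h hh r (hN.1.1 r h (mem_assigned.1 hr))
  · intro a _ b _ hab
    refine Finset.disjoint_left.2 fun r hra hrb => hab ?_
    exact Option.some.inj ((mem_assigned.1 hra).symm.trans (mem_assigned.1 hrb))

/-- The residents whose level is at least `i`. -/
def residentsFrom (s : State R H) (i : ℕ) : Finset R :=
  Finset.univ.filter fun r => (i : ℤ) ≤ s.resLevel r

theorem mem_residentsFrom {s : State R H} {i : ℕ} {r : R} :
    r ∈ residentsFrom s i ↔ (i : ℤ) ≤ s.resLevel r := by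
  simp [residentsFrom]

/-- While a hospital of level above `i` misses its lower quota, some resident has level exactly
`i`. -/
theorem residentsFrom_succ_ssubset {G : HRLQ R H} {N : R → Option H} (hN : G.IsFeasible N)
    {s : State R H} (hc : G.Consistent s) (hs : G.QueueConsistent s) {h : H} {i : ℕ}
    (hi : i < s.hosLevel h) (hlt : (assigned s.matching h).card < G.lower h) :
    residentsFrom s (i + 1) ⊂ residentsFrom s i := by
  have hsub : residentsFrom s (i + 1) ⊆ residentsFrom s i := by
    intro r hr
    rw [mem_residentsFrom] at hr ⊢
    push_cast at hr
    omega
  refine hsub.ssubset_of_ne fun heq => ?_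
  -- Suppose no resident has level exactly `i`. Hospitals in `S` have proposed to all their
  -- neighbours at level `i`, so these have level at least `i + 1` and are held inside `S`.
  -- Hospitals in `S` are above level 0, hence hold at most their lower quotas, and `h` holds fewer:
  -- `S` has more demand than neighbours.
  set S : Finset H := Finset.univ.filter fun x => i < s.hosLevel x with hS
  have h1 : ∑ x ∈ S, G.lower x ≤ (residentsFrom s (i + 1)).card := by
    refine sum_lower_le_card hN S _ fun x hx r hr => ?_
    rw [heq, mem_residentsFrom]
    exact hc.le_resLevel (hc.proposed_of_lt x i (by simpa [hS] using hx) r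
      ((G.mutual_acceptable r x).1 hr))
  have h2 : (residentsFrom s (i + 1)).card ≤ ∑ x ∈ S, (assigned s.matching x).card := by
    refine (Finset.card_le_card fun r hr => ?_).trans Finset.card_biUnion_le
    rw [mem_residentsFrom] at hr
    push_cast at hr
    cases hm : s.matching r with
    | none => have := hc.of_none r hm; omega
    | some x =>
      obtain ⟨j, hj, -, e⟩ := hc.of_some r x hm
      refine Finset.mem_biUnion.2 ⟨x, ?_, mem_assigned.2 hm⟩
      simp only [hS, Finset.mem_filter_univ]
      omega
  have h3 : ∑ x ∈ S, (assigned s.matching x).card < ∑ x ∈ S, G.lower x := by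
    refine Finset.sum_lt_sum (fun x hx => ?_) ⟨h, by simpa [hS] using hi, hlt⟩
    have h4 := hs.card_le x
    have h5 : i < s.hosLevel x := by simpa [hS] using hx
    rwa [capacity, if_neg (by omega)] at h4
  omega

theorem QueueConsistent.isFeasible {G : HRLQ R H} {N : R → Option H} (hN : G.IsFeasible N)
    {s : State R H} (hc : G.Consistent s) (hs : G.QueueConsistent s) (hq : s.queue = []) :
    G.IsFeasible s.matching := by
  have hG : ∀ h, G.lower h ≤ G.upper h := fun h => (hN.2 h).trans (hN.1.2 h)
  refine ⟨hs.isMatching hG hc, fun h => ?_⟩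
  by_contra hlt
  rw [not_le] at hlt
  rcases hs.of_notMem h (by simp [hq]) with h1 | ⟨h1, h2⟩
  · have h3 : G.lower h ≤ G.capacity h (s.hosLevel h) := by
      unfold capacity
      split_ifs
      exacts [hG h, le_rfl]
    omega
  · have hlev := h2.resolve_left (by omega)
    -- Each level costs at least one resident, so none is left at level `Fintype.card R`.
    have key : ∀ i, i ≤ Fintype.card R → (residentsFrom s i).card + i ≤ Fintype.card R := by
      intro i
      induction i with
      | zero => exact fun _ => Finset.card_le_univ _
      | succ i ih =>
        intro hi
        have h3 := Finset.card_lt_card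
          (residentsFrom_succ_ssubset hN hc hs (h := h) (i := i) (by omega) hlt)
        have h4 := ih (by omega)
        omega
    -- The lower quota of `h` is positive, so `N` supplies a neighbour, to which `h` has proposed at
    -- the top level.
    obtain ⟨r, hr⟩ : (assigned N h).Nonempty := by
      rw [← Finset.card_pos]
      have := hN.2 h
      omega
    have hr' := hc.le_resLevel
      (h1 r ((G.mutual_acceptable r h).1 (hN.1.1 r h (mem_assigned.1 hr))))
    rw [hlev] at hr'
    have h5 := Finset.card_pos.2 ⟨r, mem_residentsFrom.2 hr'⟩
    have h6 := key _ le_rfl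
    omega

/-! ### Votes -/

section Vote

variable {α : Type*} [DecidableEq α]

theorem vote_le_one (l : List α) (x y : Option α) : vote l x y ≤ 1 := by
  unfold vote; split_ifs <;> simp

theorem vote_eq_neg_one {l : List α} {x y : Option α} (h : rank l y < rank l x) :
    vote l x y = -1 := by
  rw [vote, if_neg (show ¬ Prefers l x y from h.not_gt), if_pos (show Prefers l y x from h)]

theorem vote_nonpos {l : List α} {x y : Option α} (h : rank l y ≤ rank l x) :
    vote l x y ≤ 0 := by
  rw [vote, if_neg (show ¬ Prefers l x y from not_lt.2 h)]
  split_ifs <;> simp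

theorem vote_swap (l : List α) (x y : Option α) : vote l y x = -vote l x y := by
  unfold vote Prefers
  rcases lt_trichotomy (rank l x) (rank l y) with h | h | h
  · simp [h, h.not_gt]
  · simp [h]
  · simp [h, h.not_gt]

theorem rank_le_rank_none (l : List α) (x : Option α) : rank l x ≤ rank l none := by
  cases x with
  | none => exact le_rfl
  | some a => exact List.idxOf_le_length

theorem rank_lt_of_le_of_ne {l : List α} {a b : α} (hb : b ∈ l) (hne : a ≠ b)
    (h : rank l (some a) ≤ rank l (some b)) : rank l (some a) < rank l (some b) := by
  refine lt_of_le_of_ne h fun e => hne ?_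
  exact ((List.idxOf_inj hb).1 e.symm).symm

end Vote

/-- The level of a resident, unmatched residents being counted with level `0`. -/
def natLevel (s : State R H) (r : R) : ℕ := (s.resLevel r).toNat

/-- Upper bound for the place that a resident (or nobody) takes in another matching. -/
def gain (G : HRLQ R H) (s : State R H) (h : H) : Option R → ℤ
  | some r => 2 * natLevel s r - vote (G.resList r) (some h) (s.matching r)
  | none => 0

/-- Lower bound for the place that a resident (or nobody) takes in the matching of `s`. -/
def loss (s : State R H) : Option R → ℤ
  | some r => 2 * natLevel s r
  | none => 0

/-- A resident to whom `h` has proposed with level `i` without holding `r` now. -/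
theorem Consistent.lt_natLevel_or {G : HRLQ R H} {s : State R H} (hc : G.Consistent s) {r : R}
    {h : H} {i : ℕ} (hr : r ∈ s.proposed h i) (hne : s.matching r ≠ some h) :
    i < natLevel s r ∨
      (i = natLevel s r ∧ vote (G.resList r) (some h) (s.matching r) = -1) := by
  obtain ⟨h', hm, hlt | ⟨he, hle⟩⟩ := hc.answer r h i hr
  · left; unfold natLevel; omega
  · refine Or.inr ⟨by unfold natLevel; omega, ?_⟩
    rw [hm] at hne ⊢
    exact vote_eq_neg_one (rank_lt_of_le_of_ne
      ((G.mutual_acceptable r h).2 (hc.mem_list r h i hr)) (fun e => hne (e ▸ rfl)) hle)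

/-- Let `L` be the level of `h`. If `h` proposed to `r` at `L`, the answer of `r` makes its gain at
least `2 * L + 1`. Otherwise the proposal at `L - 1` gives gain at least `2 * L - 1`; this suffices
when `y` has level below `L`, and when `y` has level `L` the prefix property makes the vote of `h`
equal to -1. -/
theorem vote_some_some_le {G : HRLQ R H} {s : State R H} (hc : G.Consistent s) {h : H} {r y : R}
    (hr : G.Edge r h) (hne : s.matching r ≠ some h) (hy : s.matching y = some h) :
    vote (G.hosList h) (some r) (some y) ≤ gain G s h (some r) - loss s (some y) := by
  have hrl := (G.mutual_acceptable r h).1 hr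
  have v1 := vote_le_one (G.hosList h) (some r) (some y)
  have v2 := vote_le_one (G.resList r) (some h) (s.matching r)
  obtain ⟨i, hi, hyi, hiy⟩ := hc.of_some y h hy
  have hiy' : natLevel s y = i := by unfold natLevel; omega
  have hbelow : ∀ j, s.hosLevel h = j + 1 → j < natLevel s r ∨
      (j = natLevel s r ∧ vote (G.resList r) (some h) (s.matching r) = -1) := fun j hj =>
    hc.lt_natLevel_or (hc.proposed_of_lt h j (by omega) r hrl) hne
  simp only [gain, loss, hiy']
  by_cases hp : r ∈ s.proposed h (s.hosLevel h)
  · rcases hc.lt_natLevel_or hp hne with h1 | ⟨h1, h2⟩ <;> omega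
  · rcases hi.eq_or_lt with rfl | hlt
    · have h3 : vote (G.hosList h) (some r) (some y) = -1 := by
        refine vote_eq_neg_one (rank_lt_of_le_of_ne hrl (fun e => hne (e ▸ hy)) ?_)
        exact not_lt.1 fun h4 => hp (hc.proposed_of_idxOf_lt y h hyi r hrl h4)
      rcases hL : s.hosLevel h with _ | j
      · omega
      · rcases hbelow j hL with h1 | ⟨h1, h2⟩ <;> omega
    · obtain ⟨j, hL⟩ := Nat.exists_eq_succ_of_ne_zero (show s.hosLevel h ≠ 0 by omega)
      have h5 := hc.le_resLevel
        (hc.proposed_of_lt h j (by omega) y (hc.mem_list y h i hyi))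
      rcases hbelow j hL with h1 | ⟨h1, h2⟩ <;> omega

/-- A hospital with a free place at the end has gone through its whole list at level 0, so `r` has
either a positive level or a partner it prefers. -/
theorem vote_some_none_le {G : HRLQ R H} {s : State R H} (hc : G.Consistent s)
    (hs : G.QueueConsistent s) (hq : s.queue = []) {h : H} {r : R} (hr : G.Edge r h)
    (hne : s.matching r ≠ some h) (hfree : (assigned s.matching h).card < G.upper h) :
    vote (G.hosList h) (some r) none ≤ gain G s h (some r) - loss s none := by
  have hrl := (G.mutual_acceptable r h).1 hr
  have v1 := vote_le_one (G.hosList h) (some r) none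
  have v2 := vote_le_one (G.resList r) (some h) (s.matching r)
  have h0 : r ∈ s.proposed h 0 := by
    rcases Nat.eq_zero_or_pos (s.hosLevel h) with hL | hL
    · rcases hs.of_notMem h (by simp [hq]) with h1 | ⟨h1, -⟩
      · rw [hL, capacity, if_pos rfl] at h1
        omega
      · rw [hL] at h1
        exact h1 r hrl
    · exact hc.proposed_of_lt h 0 hL r hrl
  simp only [gain, loss]
  rcases hc.lt_natLevel_or h0 hne with h1 | ⟨h1, h2⟩ <;> omega

/-- Holding more than the lower quota is possible only at level 0, where residents cost nothing. -/
theorem vote_none_some_le {G : HRLQ R H} {s : State R H} (hc : G.Consistent s)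
    (hs : G.QueueConsistent s) {h : H} {y : R} (hy : s.matching y = some h)
    (hlt : G.lower h < (assigned s.matching h).card) :
    vote (G.hosList h) none (some y) ≤ gain G s h none - loss s (some y) := by
  have hL : s.hosLevel h = 0 := by
    by_contra hL
    have := hs.card_le h
    rw [capacity, if_neg hL] at this
    omega
  obtain ⟨i, hi, -, hiy⟩ := hc.of_some y h hy
  have h1 := vote_nonpos (rank_le_rank_none (G.hosList h) (some y))
  have h2 : natLevel s y = 0 := by unfold natLevel; omega
  simp only [gain, loss, h2]
  omega

/-! ### Popularity -/

theorem count_some_places (G : HRLQ R H) (M : R → Option H) (h : H) (r : R) :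
    (G.places M h).count (some r) = if M r = some h then 1 else 0 := by
  have hinj : Function.Injective (some : R → Option R) := Option.some_injective R
  rw [places, Multiset.count_add, Multiset.count_replicate, if_neg (by simp), add_zero,
    Multiset.count_map_eq_count' _ _ hinj, Multiset.count_eq_of_nodup (assigned M h).nodup]
  simp [mem_assigned]

theorem count_none_places (G : HRLQ R H) (M : R → Option H) (h : H) :
    (G.places M h).count none = G.upper h - (assigned M h).card := by
  rw [places, Multiset.count_add, Multiset.count_replicate_self,
    Multiset.count_eq_zero_of_notMem (by simp), zero_add]

theorem count_some_places_sub (G : HRLQ R H) (M N : R → Option H) (h : H) (r : R) :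
    (G.places M h - G.places N h).count (some r) =
      if M r = some h ∧ N r ≠ some h then 1 else 0 := by
  rw [Multiset.count_sub, count_some_places, count_some_places]
  by_cases h1 : M r = some h <;> by_cases h2 : N r = some h <;> simp [h1, h2]

theorem some_mem_places_sub {G : HRLQ R H} {M N : R → Option H} {h : H} {r : R}
    (hr : some r ∈ G.places M h - G.places N h) : M r = some h ∧ N r ≠ some h := by
  have := Multiset.count_pos.2 hr
  rw [count_some_places_sub] at this
  by_contra hn
  simp [hn] at this

theorem none_mem_places_sub {G : HRLQ R H} {M N : R → Option H} {h : H}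
    (hr : none ∈ G.places M h - G.places N h) :
    (assigned M h).card < G.upper h ∧ (assigned M h).card < (assigned N h).card := by
  have := Multiset.count_pos.2 hr
  rw [Multiset.count_sub, count_none_places, count_none_places] at this
  omega

theorem sum_map_places_sub (G : HRLQ R H) (M N : R → Option H) (h : H) (f : Option R → ℤ)
    (hf : f none = 0) :
    ((G.places M h - G.places N h).map f).sum =
      ∑ r, if M r = some h ∧ N r ≠ some h then f (some r) else 0 := by
  rw [Finset.sum_multiset_map_count, Finset.sum_subset (Finset.subset_univ _)
    (fun x _ hx => by
      rw [Multiset.count_eq_zero_of_notMem (fun h1 => hx (Multiset.mem_toFinset.2 h1)),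
        zero_smul]),
    Fintype.sum_option, hf, smul_zero, zero_add]
  refine Finset.sum_congr rfl fun r _ => ?_
  rw [count_some_places_sub]
  split_ifs <;> simp

/-- The votes of the hospitals and residents for a feasible matching against the output, for any
pairing of the places of every hospital. -/
theorem votes_nonpos {G : HRLQ R H} {s : State R H} (hc : G.Consistent s)
    (hs : G.QueueConsistent s) (hq : s.queue = []) {N : R → Option H} (hN : G.IsFeasible N)
    (P : H → Multiset (Option R × Option R))
    (hP : ∀ h, (P h).map Prod.fst = G.places N h - G.places s.matching h ∧
      (P h).map Prod.snd = G.places s.matching h - G.places N h) :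
    ∑ r, vote (G.resList r) (N r) (s.matching r) +
      ∑ h, ((P h).map fun p => vote (G.hosList h) p.1 p.2).sum ≤ 0 := by
  have hpair : ∀ h, ∀ p ∈ P h, vote (G.hosList h) p.1 p.2 ≤ gain G s h p.1 - loss s p.2 := by
    rintro h ⟨x, y⟩ hp
    have hx : x ∈ G.places N h - G.places s.matching h :=
      (hP h).1 ▸ Multiset.mem_map_of_mem Prod.fst hp
    have hy : y ∈ G.places s.matching h - G.places N h :=
      (hP h).2 ▸ Multiset.mem_map_of_mem Prod.snd hp
    rcases x with _ | r <;> rcases y with _ | y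
    · exact vote_nonpos le_rfl
    · exact vote_none_some_le hc hs (some_mem_places_sub hy).1
        ((hN.2 h).trans_lt (none_mem_places_sub hx).2)
    · obtain ⟨h1, h2⟩ := some_mem_places_sub hx
      exact vote_some_none_le hc hs hq (hN.1.1 r h h1) h2 (none_mem_places_sub hy).1
    · obtain ⟨h1, h2⟩ := some_mem_places_sub hx
      exact vote_some_some_le hc (hN.1.1 r h h1) h2 (some_mem_places_sub hy).1
  have hhos : ∀ h, ((P h).map fun p => vote (G.hosList h) p.1 p.2).sum ≤
      ∑ r, ((if N r = some h ∧ s.matching r ≠ some h then gain G s h (some r) else 0) -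
        if s.matching r = some h ∧ N r ≠ some h then loss s (some r) else 0) := by
    intro h
    refine (Multiset.sum_map_le_sum_map _ _ (hpair h)).trans_eq ?_
    rw [Multiset.sum_map_sub, Finset.sum_sub_distrib,
      ← sum_map_places_sub G N s.matching h (gain G s h) rfl,
      ← sum_map_places_sub G s.matching N h (loss s) rfl, ← (hP h).1, ← (hP h).2,
      Multiset.map_map, Multiset.map_map]
    rfl
  -- Regrouped by resident, the bound involves only the hospitals of that resident in the two
  -- matchings.
  refine (add_le_add_right (Finset.sum_le_sum fun h _ => hhos h) _).trans ?_
  rw [Finset.sum_comm, ← Finset.sum_add_distrib]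
  refine Finset.sum_nonpos fun r _ => ?_
  rw [Finset.sum_sub_distrib]
  have hl : (0 : ℤ) ≤ loss s (some r) := by simp [loss]
  rcases hNr : N r with _ | a <;> rcases hMr : s.matching r with _ | b
  · simpa using vote_nonpos le_rfl
  · have := vote_nonpos (rank_le_rank_none (G.resList r) (some b))
    simp only [reduceCtorEq, false_and, if_false, Finset.sum_const_zero, ne_eq, not_false_eq_true,
      and_true, Option.some.injEq, Finset.sum_ite_eq, Finset.mem_univ, if_true]
    omega
  -- The level -1 truncates to 0, so the gain is exactly minus the vote of the resident.
  · have h0 : natLevel s r = 0 := by simp [natLevel, hc.of_none r hMr]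
    simp [gain, h0, hMr]
  · by_cases hab : a = b
    · subst hab
      simpa using vote_nonpos (le_refl (rank (G.resList r) (some a)))
    · have e1 : ∀ h, (some a = some h ∧ some b ≠ some h) ↔ a = h := fun h =>
        ⟨fun h1 => Option.some.inj h1.1, by rintro rfl; simpa using fun e => hab e.symm⟩
      have e2 : ∀ h, (some b = some h ∧ some a ≠ some h) ↔ b = h := fun h =>
        ⟨fun h1 => Option.some.inj h1.1, by rintro rfl; simpa using hab⟩
      simp only [e1, e2, Finset.sum_ite_eq, Finset.mem_univ, if_true, gain, loss, hMr]
      omega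

theorem QueueConsistent.isPopularAmongFeasible {G : HRLQ R H} {N : R → Option H}
    (hN : G.IsFeasible N) {s : State R H} (hc : G.Consistent s) (hs : G.QueueConsistent s)
    (hq : s.queue = []) {corr : Corr R H} (hcorr : G.IsCorr corr) :
    G.IsPopularAmongFeasible corr s.matching := by
  have hM := hs.isFeasible hN hc hq
  refine ⟨hM, fun N hN => ?_⟩
  have h1 := votes_nonpos hc hs hq hN (corr N s.matching) (hcorr _ _ hN.1 hM.1)
  -- The pairings for the two orders of the matchings need not be mutually inverse, so the bound is
  -- also applied to the swapped pairing.
  have h2 := votes_nonpos hc hs hq hN (fun h => (corr s.matching N h).map Prod.swap) fun h => by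
    obtain ⟨e1, e2⟩ := hcorr _ _ hM.1 hN.1 h
    rw [← e1, ← e2, Multiset.map_map, Multiset.map_map]
    exact ⟨rfl, rfl⟩
  have h3 : G.totalVote corr s.matching N =
      -(∑ r, vote (G.resList r) (N r) (s.matching r) +
        ∑ h, (((corr s.matching N h).map Prod.swap).map
          fun p => vote (G.hosList h) p.1 p.2).sum) := by
    rw [totalVote, neg_add, ← Finset.sum_neg_distrib, ← Finset.sum_neg_distrib]
    congr 1
    · exact Finset.sum_congr rfl fun r _ => vote_swap _ _ _
    · refine Finset.sum_congr rfl fun h _ => ?_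
      rw [hosVote, Multiset.map_map, ← Multiset.sum_map_neg', Multiset.map_map]
      refine congrArg Multiset.sum (Multiset.map_congr rfl fun p _ => ?_)
      exact vote_swap (G.hosList h) p.2 p.1
  have h4 : G.totalVote corr N s.matching ≤ 0 := h1
  unfold MorePopular
  rw [not_lt, h3]
  omega

/-! ### Stability -/

/-- While only level `0` has been used, no resident has rejected its partner in a stable matching
`S`. -/
structure LevelZero (s : State R H) (S : R → Option H) : Prop where
  level : ∀ h, s.hosLevel h = 0
  holds : ∀ r h, S r = some h → r ∈ s.proposed h 0 → s.matching r = some h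

theorem LevelZero.assigned_subset {s : State R H} {S : R → Option H} (hl : LevelZero s S) {h : H}
    (hp : ∀ y, S y = some h → y ∈ s.proposed h 0) : assigned S h ⊆ assigned s.matching h :=
  fun y hy => mem_assigned.2 (hl.holds y h (mem_assigned.1 hy) (hp y (mem_assigned.1 hy)))

/-- If `r` prefers `h` to its partner in the stable matching `S`, then `S` fills `h` with
residents that `h` prefers to `r`. -/
theorem IsStable.full_of_prefers {G : HRLQ R H} {S : R → Option H} (hS : G.IsStable S) {r : R}
    {h h₀ : H} (hr : G.Edge r h) (h0 : S r = some h₀)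
    (hp : Prefers (G.resList r) (some h) (some h₀)) :
    (assigned S h).card = G.upper h ∧
      ∀ y, S y = some h → (G.hosList h).idxOf y < (G.hosList h).idxOf r := by
  have hne : S r ≠ some h := by
    intro e
    rw [h0] at e
    rw [e] at hp
    exact lt_irrefl _ hp
  have hb := hS.2 r h
  simp only [Blocks, hr, hne, ne_eq, not_false_eq_true, true_and, not_and, not_or, not_lt] at hb
  obtain ⟨h1, h2⟩ := hb (Or.inr ⟨h₀, h0, hp⟩)
  refine ⟨le_antisymm (hS.1.2 h) h1, fun y hy => ?_⟩
  have h3 : ¬ rank (G.hosList h) (some r) < rank (G.hosList h) (some y) :=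
    fun h3 => h2 ⟨y, mem_assigned.2 hy, h3⟩
  exact rank_lt_of_le_of_ne ((G.mutual_acceptable r h).1 hr) (fun e => hne (e ▸ hy))
    (not_lt.1 h3)

/-- A first resident to abandon its `S`-partner would do so for a hospital that `S` fills with
residents it likes better; these were proposed to earlier and are still held, which overfills that
hospital. A hospital that exhausts its list holds all of its `S`-residents, so it meets its lower
quota and does not rise. -/
theorem LevelZero.step {G : HRLQ R H} {s : State R H} {S : R → Option H}
    (hS : G.IsStable S) (hF : G.IsFeasible S) (hc : G.Consistent s) (hs : G.QueueConsistent s)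
    (hl : LevelZero s S) : LevelZero (G.step s) S := by
  cases hq : s.queue with
  | nil => simpa [HRLQ.step, hq] using hl
  | cons h q =>
    have hlt := hs.card_lt h (by simp [hq])
    rw [capacity, if_pos (hl.level h)] at hlt
    have hL := hl.level h
    refine step_induction G hq (P := fun t => LevelZero t S) ?_ ?_ ?_ ?_
    · intro r l h' hr hm ha
      obtain ⟨hrl, hrp, hpre⟩ := remaining_eq_cons hr
      refine ⟨hl.level, fun x h₀ hx hxp => ?_⟩
      rcases mem_markProposed.1 hxp with hxp | ⟨rfl, -, rfl⟩
      · exact hl.holds x h₀ hx hxp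
      · by_contra hne
        obtain ⟨i, hi, hri, e⟩ := hc.of_some x h' hm
        have hi0 : i = 0 := by have := hl.level h'; omega
        subst hi0
        have hpref : Prefers (G.resList x) (some h') (some h₀) := by
          unfold Accepts at ha
          rw [hL, e] at ha
          simp only [Nat.cast_zero, lt_irrefl, true_and, false_or] at ha
          exact rank_lt_of_le_of_ne ((G.mutual_acceptable _ _).2 hrl)
            (fun e' => hne (e' ▸ hm)) (not_lt.1 ha)
        obtain ⟨h1, h2⟩ := hS.full_of_prefers (hc.edge hm) hx hpref
        have hsub := hl.assigned_subset (h := h') fun y hy => by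
          have := hc.proposed_of_idxOf_lt x h' (by rwa [hl.level h']) y
            ((G.mutual_acceptable _ _).1 (hF.1.1 y h' hy)) (h2 y hy)
          rwa [hl.level h'] at this
        have hxS : x ∉ assigned S h' := fun h3 => lt_irrefl _ (h2 x (mem_assigned.1 h3))
        -- Besides its full `S`-quota, `h'` also holds `x`, exceeding its upper quota.
        have h4 := Finset.card_lt_card ((Finset.ssubset_iff_of_subset hsub).2
          ⟨x, mem_assigned.2 hm, hxS⟩)
        have h5 := hs.card_le h'
        rw [capacity, if_pos (hl.level h')] at h5
        omega
    · intro r l q' hr ha _ _ _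
      obtain ⟨hrl, hrp, hpre⟩ := remaining_eq_cons hr
      refine ⟨hl.level, fun x h₀ hx hxp => ?_⟩
      rcases mem_markProposed.1 hxp with hold | ⟨rfl, -, rfl⟩
      · have hm := hl.holds x h₀ hx hold
        by_cases hxr : x = r
        · subst hxr
          exfalso
          have hpref : Prefers (G.resList x) (some h) (some h₀) := by
            rcases ha h₀ hm with h1 | h1
            · have := hc.le_resLevel hold
              rw [hL] at h1
              omega
            · exact h1.2
          obtain ⟨h1, h2⟩ := hS.full_of_prefers ((G.mutual_acceptable _ _).2 hrl) hx hpref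
          have hsub := hl.assigned_subset (h := h) fun y hy => by
            have := hpre y ((G.mutual_acceptable _ _).1 (hF.1.1 y h hy)) (h2 y hy)
            rwa [hL] at this
          -- Here `h` is already full, although a hospital taken from the queue has a free place.
          have h4 := Finset.card_le_card hsub
          omega
        · simpa only [Function.update_of_ne hxr] using hm
      · simp
    · intro hr _ hcl _
      exfalso
      have hsub := hl.assigned_subset (h := h) fun y hy => by
        have := remaining_eq_nil.1 hr y ((G.mutual_acceptable _ _).1 (hF.1.1 y h hy))
        rwa [hL] at this
      have h4 := Finset.card_le_card hsub
      have h5 := hF.2 h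
      omega
    · intro _ _
      exact ⟨hl.level, hl.holds⟩

/-- In a blocking pair `h` cannot have proposed to `r`, since `r` would hold something at least as
good. So `h` stopped because it was full, and the prefix property says that it prefers all its
residents to `r`. -/
theorem LevelZero.isStable {G : HRLQ R H} {s : State R H} {S : R → Option H}
    (hc : G.Consistent s) (hs : G.QueueConsistent s) (hl : LevelZero s S) (hq : s.queue = [])
    (hM : G.IsMatching s.matching) : G.IsStable s.matching := by
  refine ⟨hM, ?_⟩
  rintro r h ⟨hr, -, hres, hhos⟩
  have hrl := (G.mutual_acceptable r h).1 hr
  have hL := hl.level h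
  have hp : r ∉ s.proposed h 0 := by
    intro hp
    obtain ⟨h', hm, hans⟩ := hc.answer r h 0 hp
    rcases hres with h1 | ⟨h'', h1, hpref⟩
    · simp [hm] at h1
    · obtain rfl : h' = h'' := Option.some.inj (hm.symm.trans h1)
      obtain ⟨i, hi, -, e⟩ := hc.of_some r h' hm
      have h2 := hl.level h'
      rcases hans with h3 | ⟨-, h3⟩
      · omega
      · exact absurd hpref (not_lt.2 h3)
  rcases hs.of_notMem h (by simp [hq]) with h1 | ⟨h1, -⟩
  · rw [hL, capacity, if_pos rfl] at h1
    rcases hhos with h2 | ⟨y, hy, hpref⟩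
    · omega
    · obtain ⟨i, hi, hyi, -⟩ := hc.of_some y h (mem_assigned.1 hy)
      obtain rfl : i = 0 := by omega
      refine hp ?_
      have := hc.proposed_of_idxOf_lt y h (by rwa [hL]) r hrl hpref
      rwa [hL] at this
  · exact hp (by simpa [hL] using h1 r hrl)

theorem LevelZero.iterate {G : HRLQ R H} {s : State R H} {S : R → Option H}
    (hS : G.IsStable S) (hF : G.IsFeasible S) (hc : G.Consistent s) (hs : G.QueueConsistent s)
    (hl : LevelZero s S) (n : ℕ) : LevelZero (G.step^[n] s) S := by
  have hG : ∀ h, G.lower h ≤ G.upper h := fun h => (hF.2 h).trans (hF.1.2 h)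
  induction n with
  | zero => exact hl
  | succ n ih =>
    rw [Function.iterate_succ_apply']
    exact ih.step hS hF (hc.iterate n) (hs.iterate hG hc n)

end HRLQ

theorem mainTheorem1 {R H : Type*} [Fintype R] [Fintype H] [DecidableEq R] [DecidableEq H]
    (G : HRLQ R H) (hG : ∃ M, G.IsFeasible M)
    (order : List H) (hnodup : order.Nodup) (hall : ∀ h, h ∈ order) :
    (∃ M, G.Outputs order M) ∧
    ∀ M, G.Outputs order M →
      G.IsFeasible M ∧
      (∀ corr : HRLQ.Corr R H, G.IsCorr corr → G.IsPopularAmongFeasible corr M) ∧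
      ((∃ M', G.IsFeasible M' ∧ G.IsStable M') → G.IsStable M) := by
  obtain ⟨N, hN⟩ := hG
  have hlu : ∀ h, G.lower h ≤ G.upper h := fun h => (hN.2 h).trans (hN.1.2 h)
  have hc := HRLQ.Consistent.init G order
  have hs := HRLQ.QueueConsistent.init G hnodup hall
  constructor
  · obtain ⟨n, hn⟩ := hc.exists_queue_eq_nil
    exact ⟨_, n, hn, rfl⟩
  · rintro M ⟨n, hq, rfl⟩
    have hcn := hc.iterate n
    have hsn := hs.iterate hlu hc n
    refine ⟨hsn.isFeasible hN hcn hq,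
      fun corr hcorr => hsn.isPopularAmongFeasible hN hcn hq hcorr, ?_⟩
    rintro ⟨S, hF, hS⟩
    have hl : HRLQ.LevelZero (HRLQ.State.init order) S :=
      ⟨fun _ => rfl, fun r h _ hp => by simp [HRLQ.State.init] at hp⟩
    exact (hl.iterate hS hF hc hs n).isStable hcn hsn hq (hsn.isMatching hlu hcn)
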